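/- Let $(X,\|\cdot\|)$ be a reflexive real Banach space whose norm is Gâteaux differentiable at every nonzero point, with dual $(X^*,\|\cdot\|_*)$ and duality mapping $J(x)=\{x^*\in X^*: \langle x^*,x\rangle=\|x\|^2=\|x^*\|_*^2\}$. For a set-valued mapping $T:X\rightrightarrows X^*$ write $\operatorname{gph}T=\{(x,x^*):x^*\in T(x)\}$. Fix $\sigma>0$. **Definitions.** $T$ is *monotone* if $\langle x_1^*-x_2^*,x_1-x_2\rangle\ge 0$ for all $(x_i,x_i^*)\in\operatorname{gph}T$. It is *$\sigma$-strongly monotone* if $\langle x_1^*-x_2^*,x_1-x_2\rangle\ge\sigma\langle j_1-j_2,x_1-x_2\rangle$ for all $(x_i,x_i^*)\in\operatorname{gph}T$ and $j_i\in J(x_i)$. It is *$\sigma$-strongly maximal monotone* if it is $\sigma$-strongly monotone and $\operatorname{gph}T=\operatorname{gph}S$ for every $\sigma$-strongly monotone $S$ with $\operatorname{gph}T\subset\operatorname{gph}S$. For $W\subset X\times X^*$, $T$ is *($\sigma$-strongly) monotone with respect to $W$* if there is a globally ($\sigma$-strongly) monotone $\bar T$ with $\operatorname{gph}\bar T\cap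 W=\operatorname{gph}T\cap W$. $T$ is *$\sigma$-strongly maximal monotone of type (A) with respect to $W$* if it is $\sigma$-strongly monotone with respect to $W$ and $\operatorname{gph}T\cap W=\operatorname{gph}S\cap W$ for every $S:X\rightrightarrows X^*$ that is monotone with respect to $W$ and satisfies $\operatorname{gph}T\cap W\subset\operatorname{gph}S\cap W$. Let $(\bar x,\bar x^*)\in\operatorname{gph}T$. Around $(\bar x,\bar x^*)$, with modulus $\sigma$, we say that - $T$ is *locally strongly monotone* if $T$ is $\sigma$-strongly monotone with respect to $U\times V$ for some open sets $U\ni\bar x$, $V\ni\bar x^*$; - $T$ is *locally strongly maximal monotone of type (A)* if $T$ is $\sigma$-strongly maximal monotone of type (A) with respect to some open neighborhood $W\subset X\times X^*$ of $(\bar x,\bar x^*)$; it is so *on a rectangle* if $W$ can be chosen of the form $U\times V$ with $U,V$ open; - $T$ is *locally strongly maximal monotone of type (B)* if there are open $U\ni\bar x$, $V\ni\bar x^*$ and a $\sigma$-strongly maximal monotone $\bar T$ with $\operatorname{gph}\bar T\cap(U\times V)=\operatorname{gph}T\cap(U\times V)$. The inverse $T^{-1}$ has a *continuous single-valued localization*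 around $(\bar x^*,\bar x)$ if there are open $V\ni\bar x^*$, $U\ni\bar x$ such that $\operatorname{gph}T^{-1}\cap(V\times U)$ is the graph of a (norm-to-norm) continuous function defined on all of $V$. **Theorem.** Consider the assertions: (i) $T$ is locally strongly maximal monotone of type (B) around $(\bar x,\bar x^*)$ with modulus $\sigma$; (ii) $T$ is locally strongly monotone around $(\bar x,\bar x^*)$ with modulus $\sigma$ and $T^{-1}$ has a continuous single-valued localization around $(\bar x^*,\bar x)$; (iii) $T$ is locally strongly maximal monotone of type (A) around $(\bar x,\bar x^*)$ with modulus $\sigma$; (iii$'$) as (iii), on a rectangle. Then (i) $\Longleftrightarrow$ (iii), and (iii$'$) $\Longrightarrow$ (i). If moreover the norm is Fréchet differentiable at every nonzero point, strictly convex, and Kadec–Klee ($x_k\to x$ weakly and $\|x_k\|\to\|x\|$ imply $\|x_k-x\|\to0$ for every sequence $(x_k)$), then also (i) $\Longleftrightarrow$ (ii) and (i) $\Longleftrightarrow$ (iii$'$), so that all four assertions are equivalent. -/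

import Mathlib

open Filter Topology

namespace LocMono

/-- The graph of a set-valued mapping. -/
def gph {Y Z : Type*} (F : Y → Set Z) : Set (Y × Z) := {p | p.2 ∈ F p.1}

/-- The inverse of a set-valued mapping. -/
def inv {Y Z : Type*} (F : Y → Set Z) : Z → Set Y := fun z => {y | z ∈ F y}

/-- `F` has a continuous single-valued localization around `(y₀, z₀)`: on some open rectangle
`U × V` containing the point, the graph of `F` is the graph of a continuous function that is
defined on all of `U`. -/
def HasContinuousSingleValuedLocalization {Y Z : Type*} [TopologicalSpace Y] [TopologicalSpace Z]
    (F : Y → Set Z) (y₀ : Y) (z₀ : Z) : Prop :=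
  ∃ (U : Set Y) (V : Set Z) (f : Y → Z), IsOpen U ∧ IsOpen V ∧ y₀ ∈ U ∧ z₀ ∈ V ∧
    ContinuousOn f U ∧ gph F ∩ U ×ˢ V = {p | p.1 ∈ U ∧ p.2 = f p.1}

section Geometry

variable (X : Type*) [NormedAddCommGroup X] [NormedSpace ℝ X]

/-- Reflexivity: the canonical embedding into the bidual is onto. -/
def IsReflexiveSpace : Prop :=
  Function.Surjective (NormedSpace.inclusionInDoubleDual ℝ X)

/-- The norm is Gâteaux differentiable at every nonzero point. -/
def GateauxSmooth : Prop :=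
  ∀ x : X, x ≠ 0 → ∃ f : StrongDual ℝ X, ∀ h : X,
    HasLineDerivAt ℝ (fun y : X => ‖y‖) (f h) x h

/-- The norm is Fréchet differentiable at every nonzero point. -/
def FrechetSmooth : Prop :=
  ∀ x : X, x ≠ 0 → DifferentiableAt ℝ (fun y : X => ‖y‖) x

/-- Kadec–Klee property: a weakly convergent sequence whose norms converge to the norm of the
weak limit converges in norm. -/
def KadecKlee : Prop :=
  ∀ (u : ℕ → X) (x : X),
    (∀ f : StrongDual ℝ X, Tendsto (fun k => f (u k)) atTop (𝓝 (f x))) →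
    Tendsto (fun k => ‖u k‖) atTop (𝓝 ‖x‖) → Tendsto u atTop (𝓝 x)

end Geometry

section Monotonicity

variable {X : Type*} [NormedAddCommGroup X] [NormedSpace ℝ X]

/-- The duality mapping `J(x) = {x* | ⟨x*, x⟩ = ‖x‖² = ‖x*‖²}`. -/
def dualityMap (x : X) : Set (StrongDual ℝ X) :=
  {f | f x = ‖x‖ ^ 2 ∧ ‖x‖ ^ 2 = ‖f‖ ^ 2}

/-- Global monotonicity. -/
def IsMonotone (T : X → Set (StrongDual ℝ X)) : Prop :=
  ∀ p ∈ gph T, ∀ q ∈ gph T, 0 ≤ (p.2 - q.2) (p.1 - q.1)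

/-- Global strong monotonicity with modulus `σ`, with respect to the duality mapping. -/
def IsStronglyMonotone (σ : ℝ) (T : X → Set (StrongDual ℝ X)) : Prop :=
  ∀ p ∈ gph T, ∀ q ∈ gph T, ∀ j₁ ∈ dualityMap p.1, ∀ j₂ ∈ dualityMap q.1,
    σ * (j₁ - j₂) (p.1 - q.1) ≤ (p.2 - q.2) (p.1 - q.1)

/-- `T` is `σ`-strongly monotone and has no proper `σ`-strongly monotone extension. -/
def IsStronglyMaximalMonotone (σ : ℝ) (T : X → Set (StrongDual ℝ X)) : Prop :=
  IsStronglyMonotone σ T ∧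
    ∀ S : X → Set (StrongDual ℝ X), IsStronglyMonotone σ S → gph T ⊆ gph S → gph T = gph S

/-- Monotonicity of `T` with respect to a set `W`: on `W`, the graph of `T` is that of some
globally monotone operator. -/
def IsMonotoneOn (T : X → Set (StrongDual ℝ X)) (W : Set (X × StrongDual ℝ X)) : Prop :=
  ∃ T' : X → Set (StrongDual ℝ X), IsMonotone T' ∧ gph T' ∩ W = gph T ∩ W

/-- `σ`-strong monotonicity of `T` with respect to a set `W`. -/
def IsStronglyMonotoneOn (σ : ℝ) (T : X → Set (StrongDual ℝ X))
    (W : Set (X × StrongDual ℝ X)) : Prop :=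
  ∃ T' : X → Set (StrongDual ℝ X), IsStronglyMonotone σ T' ∧ gph T' ∩ W = gph T ∩ W

/-- Strong maximal monotonicity of type (A) with respect to a set `W`: the competitors `S` are
only required to be monotone with respect to `W`. -/
def IsStronglyMaximalMonotoneOnA (σ : ℝ) (T : X → Set (StrongDual ℝ X))
    (W : Set (X × StrongDual ℝ X)) : Prop :=
  IsStronglyMonotoneOn σ T W ∧
    ∀ S : X → Set (StrongDual ℝ X), IsMonotoneOn S W →
      gph T ∩ W ⊆ gph S ∩ W → gph T ∩ W = gph S ∩ W

/-- Local strong monotonicity with modulus `σ` around `(x, x')`. -/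
def LocallyStronglyMonotone (σ : ℝ) (T : X → Set (StrongDual ℝ X))
    (x : X) (x' : StrongDual ℝ X) : Prop :=
  ∃ (U : Set X) (V : Set (StrongDual ℝ X)), IsOpen U ∧ IsOpen V ∧ x ∈ U ∧ x' ∈ V ∧
    IsStronglyMonotoneOn σ T (U ×ˢ V)

/-- Local strong maximal monotonicity of type (A) with modulus `σ` around `(x, x')`, witnessed by
an open neighborhood `W` of the point in the product space. -/
def LocallyStronglyMaximalMonotoneA (σ : ℝ) (T : X → Set (StrongDual ℝ X))
    (x : X) (x' : StrongDual ℝ X) : Prop :=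
  ∃ W : Set (X × StrongDual ℝ X), IsOpen W ∧ (x, x') ∈ W ∧ IsStronglyMaximalMonotoneOnA σ T W

/-- The variant of type (A) in which the witnessing neighborhood is a rectangle `U × V`. -/
def LocallyStronglyMaximalMonotoneARect (σ : ℝ) (T : X → Set (StrongDual ℝ X))
    (x : X) (x' : StrongDual ℝ X) : Prop :=
  ∃ (U : Set X) (V : Set (StrongDual ℝ X)), IsOpen U ∧ IsOpen V ∧ x ∈ U ∧ x' ∈ V ∧
    IsStronglyMaximalMonotoneOnA σ T (U ×ˢ V)

/-- Local strong maximal monotonicity of type (B) with modulus `σ` around `(x, x')`: near the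
point, the graph of `T` is that of a globally `σ`-strongly maximal monotone operator. -/
def LocallyStronglyMaximalMonotoneB (σ : ℝ) (T : X → Set (StrongDual ℝ X))
    (x : X) (x' : StrongDual ℝ X) : Prop :=
  ∃ (U : Set X) (V : Set (StrongDual ℝ X)), IsOpen U ∧ IsOpen V ∧ x ∈ U ∧ x' ∈ V ∧
    ∃ T' : X → Set (StrongDual ℝ X),
      IsStronglyMaximalMonotone σ T' ∧ gph T' ∩ U ×ˢ V = gph T ∩ U ×ˢ V

end Monotonicity

end LocMono

/-!
If `T` is `σ`-strongly maximal monotone then, the duality mapping `J` being single-valued, `T - σJ`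
is maximal monotone. For `φ` convex, continuous and supercoercive, the epigraph of its Fitzpatrick
function lies above the concave function `(z, u) ↦ -φ(z) - φ*(-u)`; a separating affine function
is, by reflexivity, given by a point of `X × X*`, which turns out to lie on the graph and to be a
zero of `T - σJ + ∂φ`.

Adding `σ‖·‖²/2` and `‖· - y‖²/2 - y*` in this way gives, for each `(y, y*)`, a point `(z, z*)` of
the graph of `T` with `y* - z* ∈ J(z - y)`. It stays close to a graph point when `(y, y*)` does, so
a point near the graph that is monotonically related to the nearby part of the graph can be tested
against it and must coincide with it: type (B) implies type (A) on a small, not necessarily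
rectangular, neighbourhood. Conversely, a maximal `σ`-strongly monotone extension (Zorn) of a
mapping of type (A) cannot enlarge its local graph.

With `σ‖·‖²/2 - y*` instead one finds that `T` is onto. For graph points `(z, z*)`, `(y, y*)` and
`j ∈ J(y)`, strong monotonicity bounds `(‖z‖ - ‖y‖)²` and the defect in `⟨j, z⟩ ≤ ‖y‖‖z‖` by a
multiple of `‖z* - y*‖`, so strict convexity makes `T⁻¹` single-valued and the Kadec–Klee property
makes it continuous. Minty's trick shows that the graph of a continuous local inverse is maximal on
a rectangle.
-/

namespace LocMono

section ConvexAnalysis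

theorem exists_affine_between {E : Type*} [AddCommGroup E] [Module ℝ E] [TopologicalSpace E]
    [IsTopologicalAddGroup E] [ContinuousSMul ℝ E] {K : Set (E × ℝ)} {g : E → ℝ}
    (hK : Convex ℝ K) (hne : K.Nonempty) (hg : ConcaveOn ℝ Set.univ g) (hgc : Continuous g)
    (hle : ∀ e ∈ K, g e.1 ≤ e.2) :
    ∃ (l : StrongDual ℝ E) (c : ℝ), (∀ e ∈ K, l e.1 + c ≤ e.2) ∧ ∀ e, g e ≤ l e + c := by
  have hypograph_convex : Convex ℝ {e : E × ℝ | e.2 < g e.1} := by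
    simpa using hg.convex_strict_hypograph
  have hypograph_open : IsOpen {e : E × ℝ | e.2 < g e.1} :=
    isOpen_lt continuous_snd (hgc.comp continuous_fst)
  obtain ⟨f, s, hf_lt, hf_ge⟩ := geometric_hahn_banach_open hypograph_convex hypograph_open hK
    (Set.disjoint_left.mpr fun e he heK => (hle e heK).not_gt he)
  set t : ℝ := f (0, 1)
  have hf : ∀ e r, f (e, r) = f (e, 0) + r * t := fun e r => by
    rw [← smul_eq_mul, ← map_smul, ← map_add]
    simp
  have ht : 0 < t := by
    obtain ⟨⟨e, r⟩, he⟩ := hne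
    have below : f (e, g e - 1) < s := hf_lt _ (sub_one_lt (g e))
    have above : s ≤ f (e, r) := hf_ge _ he
    rw [hf] at below above
    have hgap : 0 < (r - (g e - 1)) * t := by linarith
    exact pos_of_mul_pos_right hgap (by linarith [hle _ he])
  refine ⟨-(t⁻¹ • f.comp (ContinuousLinearMap.inl ℝ E ℝ)), t⁻¹ * s, ?_, fun e => ?_⟩
  · rintro ⟨e, r⟩ he
    have hs : t⁻¹ * (s - f (e, 0)) ≤ r := by
      rw [inv_mul_le_iff₀ ht]
      linarith [hf_ge _ he, hf e r]
    rw [mul_sub] at hs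
    change -(t⁻¹ * f (e, 0)) + t⁻¹ * s ≤ r
    linarith
  · have hs : g e ≤ t⁻¹ * (s - f (e, 0)) := le_of_forall_lt fun r hr => by
      rw [lt_inv_mul_iff₀ ht]
      linarith [hf_lt (e, r) hr, hf e r]
    rw [mul_sub] at hs
    change g e ≤ -(t⁻¹ * f (e, 0)) + t⁻¹ * s
    linarith

variable {E : Type*} [NormedAddCommGroup E] {φ ψ : E → ℝ}

/-- `φ` grows faster than every multiple of the norm. -/
def IsSupercoercive (φ : E → ℝ) : Prop :=
  ∀ r : ℝ, ∃ C, ∀ z, r * ‖z‖ - C ≤ φ z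

theorem isSupercoercive_of_quadratic_le {a b : ℝ} (ha : 0 < a)
    (h : ∀ z, a * ‖z‖ ^ 2 - b * ‖z‖ ≤ φ z) : IsSupercoercive φ := by
  refine fun r => ⟨(r + b) ^ 2 / (4 * a), fun z => le_trans ?_ (h z)⟩
  have hsq : a * ‖z‖ ^ 2 - b * ‖z‖ - (r * ‖z‖ - (r + b) ^ 2 / (4 * a)) =
      (2 * a * ‖z‖ - (r + b)) ^ 2 / (4 * a) := by
    field_simp
    ring
  have hnonneg : 0 ≤ (2 * a * ‖z‖ - (r + b)) ^ 2 / (4 * a) := by positivity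
  linarith

variable [NormedSpace ℝ E]

/-- `f` is a subgradient of `φ` at `x`, that is, `f ∈ ∂φ(x)`. -/
def IsSubgradient (φ : E → ℝ) (x : E) (f : StrongDual ℝ E) : Prop :=
  ∀ z, φ x + f (z - x) ≤ φ z

theorem IsSubgradient.sub_of_hasLineDerivAt {x : E} {f g : StrongDual ℝ E}
    (hf : IsSubgradient (fun z => φ z + ψ z) x f) (hg : ∀ h, HasLineDerivAt ℝ φ (g h) x h)
    (hψ : ConvexOn ℝ Set.univ ψ) : IsSubgradient ψ x (f - g) := by
  intro z
  suffices h : f (z - x) - (ψ z - ψ x) ≤ g (z - x) by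
    rw [sub_apply]
    linarith
  refine ge_of_tendsto (hg (z - x)).tendsto_slope_zero_right ?_
  filter_upwards [Ioc_mem_nhdsGT one_pos] with t ht
  have subgradient_ineq := hf (x + t • (z - x))
  have convex_ineq := hψ.2 (Set.mem_univ x) (Set.mem_univ z) (sub_nonneg.mpr ht.2) ht.1.le
    (sub_add_cancel 1 t)
  rw [show (1 - t) • x + t • z = x + t • (z - x) by module] at convex_ineq
  rw [add_sub_cancel_left, map_smul] at subgradient_ineq
  simp only [smul_eq_mul] at subgradient_ineq convex_ineq ⊢
  rw [le_inv_mul_iff₀ ht.1]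
  linarith

theorem IsSubgradient.eq_of_hasLineDerivAt {x : E} {f g : StrongDual ℝ E}
    (hf : IsSubgradient φ x f) (hg : ∀ h, HasLineDerivAt ℝ φ (g h) x h) : f = g := by
  have hsub : IsSubgradient (fun _ => 0) x (f - g) :=
    IsSubgradient.sub_of_hasLineDerivAt (by simpa using hf) hg (convexOn_const 0 convex_univ)
  ext h
  have hle := hsub (x + h)
  have hge := hsub (x - h)
  simp only [add_sub_cancel_left, sub_sub_cancel_left, map_neg, sub_apply] at hle hge
  linarith

theorem IsSupercoercive.exists_apply_sub_le (hφ : IsSupercoercive φ) (r : ℝ) :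
    ∃ C, ∀ u : StrongDual ℝ E, ‖u‖ ≤ r → ∀ z, u z - φ z ≤ C := by
  obtain ⟨C, hC⟩ := hφ r
  refine ⟨C, fun u hu z => ?_⟩
  linarith [hC z, (le_abs_self _).trans (u.le_of_opNorm_le hu z)]

/-- The Fenchel conjugate `φ*(u) = sup_z (⟨u, z⟩ - φ(z))`, with the junk value `0` where the
supremum is infinite; for supercoercive `φ` it is finite everywhere. -/
noncomputable def conjugate (φ : E → ℝ) (u : StrongDual ℝ E) : ℝ :=
  ⨆ z, (u z - φ z)

theorem conjugate_le {u : StrongDual ℝ E} {C : ℝ} (h : ∀ z, u z - φ z ≤ C) :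
    conjugate φ u ≤ C :=
  ciSup_le h

theorem IsSupercoercive.apply_sub_le_conjugate (hφ : IsSupercoercive φ) (u : StrongDual ℝ E)
    (z : E) : u z - φ z ≤ conjugate φ u := by
  obtain ⟨C, hC⟩ := hφ.exists_apply_sub_le ‖u‖
  exact le_ciSup ⟨C, Set.forall_mem_range.mpr (hC u le_rfl)⟩ z

theorem IsSupercoercive.convexOn_conjugate (hφ : IsSupercoercive φ) :
    ConvexOn ℝ Set.univ (conjugate φ) := by
  refine ⟨convex_univ, fun u _ v _ s t hs ht hst => conjugate_le fun z => ?_⟩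
  have hu := mul_le_mul_of_nonneg_left (hφ.apply_sub_le_conjugate u z) hs
  have hv := mul_le_mul_of_nonneg_left (hφ.apply_sub_le_conjugate v z) ht
  have hsum : φ z = s * φ z + t * φ z := by rw [← add_mul, hst, one_mul]
  simp only [add_apply, smul_apply, smul_eq_mul]
  linarith

theorem IsSupercoercive.continuous_conjugate (hφ : IsSupercoercive φ) :
    Continuous (conjugate φ) := by
  obtain ⟨C, hC⟩ := hφ.exists_apply_sub_le 1
  have hbdd : (𝓝 (0 : StrongDual ℝ E)).IsBoundedUnder (· ≤ ·) (conjugate φ) := by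
    refine ⟨C, eventually_map.mpr ?_⟩
    filter_upwards [Metric.closedBall_mem_nhds (0 : StrongDual ℝ E) one_pos] with u hu
    exact conjugate_le (hC u (mem_closedBall_zero_iff.mp hu))
  refine continuousOn_univ.mp
    (((hφ.convexOn_conjugate.continuousOn_tfae isOpen_univ Set.univ_nonempty).out 3 1).mp ?_)
  exact ⟨0, Set.mem_univ 0, hbdd⟩

theorem le_of_forall_apply_sub_conjugate_le (hφ : ConvexOn ℝ Set.univ φ)
    (hφc : LowerSemicontinuous φ) {x : E} {b : ℝ} (h : ∀ u, u x - conjugate φ u ≤ b) :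
    φ x ≤ b := by
  refine le_of_forall_lt_imp_le_of_dense fun a ha => ?_
  obtain ⟨l, c, hle, heq⟩ := hφ.exists_affine_le_of_lt (𝕜 := ℝ) (Set.mem_univ x) ha
    isClosed_univ (hφc.lowerSemicontinuousOn _)
  have hconj : conjugate φ l ≤ -c := conjugate_le fun z => by
    have hz : l z + c ≤ φ z := hle ⟨z, Set.mem_univ z⟩
    linarith
  have hx : l x + c = a := heq
  linarith [h l]

end ConvexAnalysis

section DualityMap

variable {X : Type*} [NormedAddCommGroup X] [NormedSpace ℝ X] {x y : X} {j k : StrongDual ℝ X}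

theorem exists_mem_dualityMap (x : X) : ∃ j, j ∈ dualityMap x := by
  by_cases hx : x = 0
  · exact ⟨0, by simp [dualityMap, hx]⟩
  obtain ⟨g, hg, hgx⟩ := exists_dual_vector ℝ x (norm_ne_zero_iff.mpr hx)
  refine ⟨‖x‖ • g, ?_, ?_⟩
  · simp only [smul_apply, smul_eq_mul, hgx, RCLike.ofReal_real_eq_id, id]
    ring
  · rw [norm_smul, norm_norm, hg, mul_one]

theorem norm_eq_of_mem_dualityMap (hj : j ∈ dualityMap x) : ‖j‖ = ‖x‖ :=
  ((pow_left_inj₀ (norm_nonneg _) (norm_nonneg _) two_ne_zero).mp hj.2).symm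

theorem apply_le_of_mem_dualityMap (hj : j ∈ dualityMap x) (y : X) : j y ≤ ‖x‖ * ‖y‖ := by
  rw [← norm_eq_of_mem_dualityMap hj]
  exact (le_abs_self _).trans (j.le_opNorm y)

theorem sub_apply_sub_of_mem_dualityMap (hj : j ∈ dualityMap x) (hk : k ∈ dualityMap y) :
    (j - k) (x - y) = (‖x‖ - ‖y‖) ^ 2 + (‖x‖ * ‖y‖ - j y) + (‖y‖ * ‖x‖ - k x) := by
  simp only [sub_apply, map_sub, hj.1, hk.1]
  ring

theorem dualityMap_monotone (hj : j ∈ dualityMap x) (hk : k ∈ dualityMap y) :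
    0 ≤ (j - k) (x - y) := by
  rw [sub_apply_sub_of_mem_dualityMap hj hk]
  linarith [sq_nonneg (‖x‖ - ‖y‖), apply_le_of_mem_dualityMap hj y,
    apply_le_of_mem_dualityMap hk x]

theorem convexOn_half_norm_sub_sq (x : X) : ConvexOn ℝ Set.univ fun z => ‖z - x‖ ^ 2 / 2 := by
  have hpow : ConvexOn ℝ Set.univ fun z => ‖z - x‖ ^ 2 := by
    simpa only [dist_eq_norm, Pi.pow_def] using
      (convexOn_univ_dist x).pow (fun _ _ => dist_nonneg) 2
  simpa only [smul_eq_mul, div_eq_inv_mul] using hpow.smul (inv_nonneg.mpr zero_le_two)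

theorem isSubgradient_of_mem_dualityMap (hj : j ∈ dualityMap x) :
    IsSubgradient (fun z => ‖z‖ ^ 2 / 2) x j := by
  intro z
  rw [map_sub, hj.1]
  linarith [apply_le_of_mem_dualityMap hj z, two_mul_le_add_sq ‖x‖ ‖z‖]

theorem GateauxSmooth.exists_hasLineDerivAt_half_norm_sq (hX : GateauxSmooth X) (x : X) :
    ∃ f : StrongDual ℝ X, ∀ h, HasLineDerivAt ℝ (fun z => ‖z‖ ^ 2 / 2) (f h) x h := by
  by_cases hx : x = 0
  · subst hx
    refine ⟨0, fun h => ?_⟩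
    have hderiv : HasDerivAt (fun t : ℝ => t ^ 2 * (‖h‖ ^ 2 / 2)) 0 0 := by
      simpa using (hasDerivAt_pow 2 (0 : ℝ)).mul_const (‖h‖ ^ 2 / 2)
    refine hderiv.congr_of_eventuallyEq (.of_forall fun t => ?_)
    simp only [zero_add, norm_smul, mul_pow, Real.norm_eq_abs, sq_abs, mul_div_assoc]
  · obtain ⟨f, hf⟩ := hX x hx
    refine ⟨‖x‖ • f, fun h => ?_⟩
    have hderiv : HasDerivAt (fun t : ℝ => ‖x + t • h‖ ^ 2 / 2) _ 0 :=
      (HasDerivAt.pow (hf h) 2).div_const 2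
    refine hderiv.congr_deriv ?_
    simp [mul_assoc]

theorem GateauxSmooth.hasLineDerivAt_half_norm_sq (hX : GateauxSmooth X) (hj : j ∈ dualityMap x)
    (h : X) : HasLineDerivAt ℝ (fun z => ‖z‖ ^ 2 / 2) (j h) x h := by
  obtain ⟨f, hf⟩ := hX.exists_hasLineDerivAt_half_norm_sq x
  rw [(isSubgradient_of_mem_dualityMap hj).eq_of_hasLineDerivAt hf]
  exact hf h

theorem GateauxSmooth.eq_of_mem_dualityMap (hX : GateauxSmooth X) (hj : j ∈ dualityMap x)
    (hk : k ∈ dualityMap x) : j = k :=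
  (isSubgradient_of_mem_dualityMap hj).eq_of_hasLineDerivAt (hX.hasLineDerivAt_half_norm_sq hk)

end DualityMap

section Rockafellar

variable {X : Type*} [NormedAddCommGroup X] [NormedSpace ℝ X] {T : X → Set (StrongDual ℝ X)}

/-- `T` is monotone, and every point monotonically related to its graph belongs to it. For
monotone `T` this is the absence of a proper monotone extension. -/
def IsMaximalMonotone (T : X → Set (StrongDual ℝ X)) : Prop :=
  IsMonotone T ∧ ∀ p, (∀ q ∈ gph T, 0 ≤ (q.2 - p.2) (q.1 - p.1)) → p ∈ gph T

/-- The epigraph of the Fitzpatrick function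
`F(z, u) = sup {⟨u, y⟩ + ⟨v, z⟩ - ⟨v, y⟩ | (y, v) ∈ gph T}`, which may take infinite values. -/
def fitzpatrickEpigraph (T : X → Set (StrongDual ℝ X)) : Set ((X × StrongDual ℝ X) × ℝ) :=
  {e | ∀ q ∈ gph T, e.1.2 q.1 + q.2 e.1.1 - q.2 q.1 ≤ e.2}

theorem convex_fitzpatrickEpigraph (T : X → Set (StrongDual ℝ X)) :
    Convex ℝ (fitzpatrickEpigraph T) := by
  intro d hd e he s t hs ht hst q hq
  have hdq := mul_le_mul_of_nonneg_left (hd q hq) hs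
  have heq := mul_le_mul_of_nonneg_left (he q hq) ht
  have hsum : q.2 q.1 = s * q.2 q.1 + t * q.2 q.1 := by rw [← add_mul, hst, one_mul]
  simp only [Prod.fst_add, Prod.snd_add, Prod.smul_fst, Prod.smul_snd, map_add, map_smul,
    add_apply, smul_apply, smul_eq_mul]
  linarith

theorem IsMonotone.mem_fitzpatrickEpigraph (hT : IsMonotone T) {p : X × StrongDual ℝ X}
    (hp : p ∈ gph T) : (p, p.2 p.1) ∈ fitzpatrickEpigraph T := by
  intro q hq
  have hpq := hT p hp q hq
  simp only [sub_apply, map_sub] at hpq ⊢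
  linarith

theorem IsMaximalMonotone.apply_le_of_mem_fitzpatrickEpigraph (hT : IsMaximalMonotone T)
    {e : (X × StrongDual ℝ X) × ℝ} (he : e ∈ fitzpatrickEpigraph T) : e.1.2 e.1.1 ≤ e.2 := by
  by_cases hmem : e.1 ∈ gph T
  · linarith [he e.1 hmem]
  · obtain ⟨q, hq, hneg⟩ : ∃ q ∈ gph T, (q.2 - e.1.2) (q.1 - e.1.1) < 0 := by
      by_contra! hrelated
      exact hmem (hT.2 e.1 hrelated)
    simp only [sub_apply, map_sub] at hneg
    linarith [he q hq]

theorem IsMaximalMonotone.nonempty_gph (hT : IsMaximalMonotone T) : (gph T).Nonempty := by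
  by_contra hempty
  rw [Set.not_nonempty_iff_eq_empty] at hempty
  have hzero : (0 : X × StrongDual ℝ X) ∈ gph T := hT.2 0 (by simp [hempty])
  simp [hempty] at hzero

theorem IsReflexiveSpace.exists_apply_eq_add (hX : IsReflexiveSpace X)
    {Y : Type*} [NormedAddCommGroup Y] [NormedSpace ℝ Y]
    (l : StrongDual ℝ (Y × StrongDual ℝ X)) :
    ∃ (w : StrongDual ℝ Y) (p : X), ∀ z u, l (z, u) = w z + u p := by
  obtain ⟨p, hp⟩ := hX (l.comp (ContinuousLinearMap.inr ℝ Y (StrongDual ℝ X)))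
  refine ⟨l.comp (ContinuousLinearMap.inl ℝ Y (StrongDual ℝ X)), p, fun z u => ?_⟩
  rw [← NormedSpace.dual_def ℝ X p u, hp]
  simp [← map_add]

theorem IsMaximalMonotone.exists_affine_between (hT : IsMaximalMonotone T)
    (hrefl : IsReflexiveSpace X) {φ : X → ℝ} (hφ : ConvexOn ℝ Set.univ φ) (hφc : Continuous φ)
    (hφs : IsSupercoercive φ) :
    ∃ (p : X) (w : StrongDual ℝ X) (c : ℝ), (∀ q ∈ gph T, w q.1 + q.2 p + c ≤ q.2 q.1) ∧
      ∀ z u, -φ z - conjugate φ u ≤ w z - u p + c := by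
  let g : X × StrongDual ℝ X → ℝ := -(φ ∘ Prod.fst) - (conjugate φ ∘ Neg.neg ∘ Prod.snd)
  have hg : ConcaveOn ℝ Set.univ g :=
    (hφ.comp_linearMap (LinearMap.fst ℝ X (StrongDual ℝ X))).neg.sub
      (hφs.convexOn_conjugate.comp_linearMap (-LinearMap.snd ℝ X (StrongDual ℝ X)))
  have hgc : Continuous g := (hφc.comp continuous_fst).neg.sub
    (hφs.continuous_conjugate.comp (continuous_neg.comp continuous_snd))
  have hle : ∀ e ∈ fitzpatrickEpigraph T, g e.1 ≤ e.2 := fun e he => by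
    have fenchel_young := hφs.apply_sub_le_conjugate (-e.1.2) e.1.1
    rw [neg_apply] at fenchel_young
    change -φ e.1.1 - conjugate φ (-e.1.2) ≤ e.2
    linarith [hT.apply_le_of_mem_fitzpatrickEpigraph he]
  obtain ⟨q, hq⟩ := hT.nonempty_gph
  obtain ⟨l, c, hl_le, hl_ge⟩ := LocMono.exists_affine_between (convex_fitzpatrickEpigraph T)
    ⟨_, hT.1.mem_fitzpatrickEpigraph hq⟩ hg hgc hle
  obtain ⟨w, p, hl⟩ := hrefl.exists_apply_eq_add l
  refine ⟨p, w, c, fun q hq => ?_, fun z u => ?_⟩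
  · have hq_le := hl_le _ (hT.1.mem_fitzpatrickEpigraph hq)
    rwa [hl] at hq_le
  · have hzu : -φ z - conjugate φ (- -u) ≤ l (z, -u) + c := hl_ge (z, -u)
    rwa [hl, neg_apply, neg_neg, ← sub_eq_add_neg] at hzu

theorem IsMaximalMonotone.exists_neg_isSubgradient (hT : IsMaximalMonotone T)
    (hrefl : IsReflexiveSpace X) {φ : X → ℝ} (hφ : ConvexOn ℝ Set.univ φ) (hφc : Continuous φ)
    (hφs : IsSupercoercive φ) : ∃ p ∈ gph T, IsSubgradient φ p.1 (-p.2) := by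
  obtain ⟨p, w, c, hw, hwφ⟩ := hT.exists_affine_between hrefl hφ hφc hφs
  have hφp : ∀ z, φ p ≤ φ z + w z + c := fun z =>
    le_of_forall_apply_sub_conjugate_le hφ hφc.lowerSemicontinuous fun u => by linarith [hwφ z u]
  -- `z = p` gives `-⟨w, p⟩ ≤ c`, so `(p, w)` lies on the graph, which in turn gives `c ≤ -⟨w, p⟩`.
  have hp : (p, w) ∈ gph T := hT.2 (p, w) fun q hq => by
    simp only [sub_apply, map_sub]
    linarith [hw q hq, hφp p]
  refine ⟨(p, w), hp, fun z => ?_⟩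
  rw [neg_apply, map_sub]
  linarith [hφp z, hw _ hp]

end Rockafellar

section StronglyMaximalMonotone

variable {X : Type*} [NormedAddCommGroup X] [NormedSpace ℝ X] {σ : ℝ}
  {T : X → Set (StrongDual ℝ X)}

theorem IsStronglyMonotone.isMonotone (hT : IsStronglyMonotone σ T) (hσ : 0 ≤ σ) :
    IsMonotone T := by
  intro p hp q hq
  obtain ⟨j, hj⟩ := exists_mem_dualityMap p.1
  obtain ⟨k, hk⟩ := exists_mem_dualityMap q.1
  exact (mul_nonneg hσ (dualityMap_monotone hj hk)).trans (hT p hp q hq j hj k hk)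

theorem IsStronglyMonotone.exists_maximal (hT : IsStronglyMonotone σ T) :
    ∃ T', IsStronglyMaximalMonotone σ T' ∧ gph T ⊆ gph T' := by
  let stronglyMonotoneGraphs : Set (Set (X × StrongDual ℝ X)) :=
    {G | IsStronglyMonotone σ fun y => {f | (y, f) ∈ G}}
  have hchain : ∀ c ⊆ stronglyMonotoneGraphs, IsChain (· ⊆ ·) c → c.Nonempty →
      ∃ ub ∈ stronglyMonotoneGraphs, ∀ s ∈ c, s ⊆ ub := by
    refine fun c hc hchain _ => ⟨⋃₀ c, ?_, fun s hs => Set.subset_sUnion_of_mem hs⟩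
    rintro p ⟨s, hs, hps⟩ q ⟨t, ht, hqt⟩
    rcases hchain.total hs ht with hst | hts
    · exact hc ht p (hst hps) q hqt
    · exact hc hs p hps q (hts hqt)
  obtain ⟨G, hTG, hG⟩ := zorn_subset_nonempty _ hchain (gph T) hT
  exact ⟨fun y => {f | (y, f) ∈ G}, ⟨hG.1, fun S hS hGS => hGS.antisymm (hG.2 hS hGS)⟩, hTG⟩

theorem IsStronglyMaximalMonotone.mem_gph (hT : IsStronglyMaximalMonotone σ T)
    {p : X × StrongDual ℝ X}
    (h : ∀ q ∈ gph T, ∀ j ∈ dualityMap q.1, ∀ k ∈ dualityMap p.1,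
      σ * (j - k) (q.1 - p.1) ≤ (q.2 - p.2) (q.1 - p.1)) : p ∈ gph T := by
  let S : X → Set (StrongDual ℝ X) := fun y => {f | (y, f) ∈ insert p (gph T)}
  have hS : IsStronglyMonotone σ S := by
    intro q hq r hr j hj k hk
    rcases Set.mem_insert_iff.mp hq with rfl | hqT <;>
      rcases Set.mem_insert_iff.mp hr with rfl | hrT
    · simp
    · have hrelated := h r hrT k hk j hj
      simp only [sub_apply, map_sub] at hrelated ⊢
      linarith
    · exact h q hqT j hj k hk
    · exact hT.1 q hqT r hrT j hj k hk
  rw [hT.2 S hS (Set.subset_insert p (gph T))]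
  exact Set.mem_insert p (gph T)

theorem IsStronglyMaximalMonotone.isMaximalMonotone_sub (hT : IsStronglyMaximalMonotone σ T)
    (hsmooth : GateauxSmooth X) {J : X → StrongDual ℝ X} (hJ : ∀ y, J y ∈ dualityMap y) :
    IsMaximalMonotone fun y => {f | f + σ • J y ∈ T y} := by
  refine ⟨fun p hp q hq => ?_, fun p hp => hT.mem_gph (p := (p.1, p.2 + σ • J p.1)) ?_⟩
  · have hpq := hT.1 (p.1, p.2 + σ • J p.1) hp (q.1, q.2 + σ • J q.1) hq _ (hJ p.1) _ (hJ q.1)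
    simp only [add_apply, sub_apply, smul_apply, smul_eq_mul] at hpq ⊢
    linarith
  · intro q hq j hj k hk
    have hqp := hp (q.1, q.2 - σ • J q.1) (by simpa [gph] using hq)
    rw [hsmooth.eq_of_mem_dualityMap hj (hJ _), hsmooth.eq_of_mem_dualityMap hk (hJ _)]
    simp only [add_apply, sub_apply, smul_apply, smul_eq_mul] at hqp ⊢
    linarith

theorem IsStronglyMaximalMonotone.exists_neg_isSubgradient (hT : IsStronglyMaximalMonotone σ T)
    (hrefl : IsReflexiveSpace X) (hsmooth : GateauxSmooth X) (hσ : 0 ≤ σ) {φ : X → ℝ}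
    (hφ : ConvexOn ℝ Set.univ φ) (hφc : Continuous φ)
    (hφs : IsSupercoercive fun z => σ * (‖z‖ ^ 2 / 2) + φ z) :
    ∃ p ∈ gph T, IsSubgradient φ p.1 (-p.2) := by
  choose J hJ using exists_mem_dualityMap (X := X)
  have hsq : ConvexOn ℝ Set.univ fun z : X => σ * (‖z‖ ^ 2 / 2) := by
    simpa only [sub_zero, smul_eq_mul] using (convexOn_half_norm_sub_sq (0 : X)).smul hσ
  obtain ⟨p, hp, hsub⟩ := (hT.isMaximalMonotone_sub hsmooth hJ).exists_neg_isSubgradient hrefl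
    (hsq.add hφ) (by fun_prop) hφs
  refine ⟨(p.1, p.2 + σ • J p.1), hp, ?_⟩
  rw [neg_add, ← sub_eq_add_neg]
  exact hsub.sub_of_hasLineDerivAt
    (fun h => (hsmooth.hasLineDerivAt_half_norm_sq (hJ p.1) h).const_mul σ) hφ

theorem IsStronglyMaximalMonotone.exists_sub_mem_dualityMap (hT : IsStronglyMaximalMonotone σ T)
    (hrefl : IsReflexiveSpace X) (hsmooth : GateauxSmooth X) (hσ : 0 ≤ σ)
    (w : X × StrongDual ℝ X) : ∃ q ∈ gph T, w.2 - q.2 ∈ dualityMap (q.1 - w.1) := by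
  have supercoercive :
      IsSupercoercive fun z => σ * (‖z‖ ^ 2 / 2) + (‖z - w.1‖ ^ 2 / 2 - w.2 z) := by
    refine isSupercoercive_of_quadratic_le (b := ‖w.1‖ + ‖w.2‖) one_half_pos fun z => ?_
    have hsq : (‖z‖ - ‖w.1‖) ^ 2 ≤ ‖z - w.1‖ ^ 2 :=
      sq_le_sq.mpr ((abs_norm_sub_norm_le z w.1).trans (le_abs_self _))
    have hw : w.2 z ≤ ‖w.2‖ * ‖z‖ := (le_abs_self _).trans (w.2.le_opNorm z)
    have hσz : 0 ≤ σ * (‖z‖ ^ 2 / 2) := by positivity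
    linarith [sq_nonneg ‖w.1‖]
  obtain ⟨q, hq, hsub⟩ := hT.exists_neg_isSubgradient hrefl hsmooth hσ
    ((convexOn_half_norm_sub_sq w.1).sub (w.2.toLinearMap.concaveOn convex_univ))
    (by fun_prop) supercoercive
  refine ⟨q, hq, ?_⟩
  have hsub' : IsSubgradient (fun v => ‖v‖ ^ 2 / 2) (q.1 - w.1) (w.2 - q.2) := fun v => by
    have hv : ‖q.1 - w.1‖ ^ 2 / 2 - w.2 q.1 + (-q.2) (v + w.1 - q.1) ≤
        ‖v + w.1 - w.1‖ ^ 2 / 2 - w.2 (v + w.1) := hsub (v + w.1)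
    simp only [add_sub_cancel_right, neg_apply, sub_apply, map_sub, map_add] at hv ⊢
    linarith
  obtain ⟨j, hj⟩ := exists_mem_dualityMap (q.1 - w.1)
  rwa [hsub'.eq_of_hasLineDerivAt (hsmooth.hasLineDerivAt_half_norm_sq hj)]

theorem IsStronglyMaximalMonotone.exists_mem_gph (hT : IsStronglyMaximalMonotone σ T)
    (hrefl : IsReflexiveSpace X) (hsmooth : GateauxSmooth X) (hσ : 0 < σ) (u : StrongDual ℝ X) :
    ∃ z, (z, u) ∈ gph T := by
  have supercoercive : IsSupercoercive fun z => σ * (‖z‖ ^ 2 / 2) + (-u) z := by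
    refine isSupercoercive_of_quadratic_le (b := ‖u‖) (half_pos hσ) fun z => ?_
    have hu : u z ≤ ‖u‖ * ‖z‖ := (le_abs_self _).trans (u.le_opNorm z)
    rw [neg_apply]
    linarith
  obtain ⟨p, hp, hsub⟩ := hT.exists_neg_isSubgradient hrefl hsmooth hσ.le
    ((-u).toLinearMap.convexOn convex_univ) (-u).continuous supercoercive
  have hpu : p.2 = u := by
    refine neg_inj.mp (hsub.eq_of_hasLineDerivAt (g := -u) fun h => ?_)
    exact (-u).hasFDerivAt.hasLineDerivAt h
  exact ⟨p.1, hpu ▸ hp⟩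

end StronglyMaximalMonotone

section LocalMaximality

variable {X : Type*} [NormedAddCommGroup X] [NormedSpace ℝ X] {σ : ℝ}
  {T : X → Set (StrongDual ℝ X)} {x : X} {x' : StrongDual ℝ X} {W : Set (X × StrongDual ℝ X)}

theorem inter_eq_inter_of_subset {α : Type*} {A B W W' : Set α} (h : A ∩ W = B ∩ W)
    (hW : W' ⊆ W) : A ∩ W' = B ∩ W' := by
  rw [← Set.inter_eq_self_of_subset_right hW, ← Set.inter_assoc, h, Set.inter_assoc]

theorem IsStronglyMonotoneOn.mono (hT : IsStronglyMonotoneOn σ T W)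
    {W' : Set (X × StrongDual ℝ X)} (hW : W' ⊆ W) : IsStronglyMonotoneOn σ T W' := by
  obtain ⟨T', hT', heq⟩ := hT
  exact ⟨T', hT', inter_eq_inter_of_subset heq hW⟩

theorem IsStronglyMonotoneOn.isStronglyMaximalMonotoneOnA (hT : IsStronglyMonotoneOn σ T W)
    (h : ∀ w ∈ W, (∀ q ∈ gph T ∩ W, 0 ≤ (w.2 - q.2) (w.1 - q.1)) → w ∈ gph T) :
    IsStronglyMaximalMonotoneOnA σ T W := by
  refine ⟨hT, ?_⟩
  rintro S ⟨S', hS', hSS'⟩ hTS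
  rw [← hSS'] at hTS ⊢
  exact hTS.antisymm fun w hw => ⟨h w hw.2 fun q hq => hS' w hw.1 q (hTS hq).1, hw.2⟩

theorem IsMonotone.dist_le_of_sub_mem_dualityMap (hT : IsMonotone T) {p q w : X × StrongDual ℝ X}
    (hp : p ∈ gph T) (hq : q ∈ gph T) (hj : w.2 - q.2 ∈ dualityMap (q.1 - w.1)) :
    dist q w ≤ 3 * dist w p := by
  have hnorm := norm_eq_of_mem_dualityMap hj
  have hdist : dist q w = ‖q.1 - w.1‖ := by
    rw [Prod.dist_eq, dist_eq_norm, dist_comm q.2, dist_eq_norm, hnorm, max_self]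
  set r := ‖q.1 - w.1‖
  set δ := dist w p
  have hfst : ‖w.1 - p.1‖ ≤ δ := (dist_eq_norm w.1 p.1).symm.trans_le (le_max_left _ _)
  have hsnd : ‖w.2 - p.2‖ ≤ δ := (dist_eq_norm w.2 p.2).symm.trans_le (le_max_right _ _)
  have hr : 0 ≤ r := norm_nonneg _
  have hδ : 0 ≤ δ := dist_nonneg
  have hquad : r ^ 2 ≤ 2 * δ * r + δ ^ 2 := by
    have hmono : 0 ≤ ((w.2 - p.2) - (w.2 - q.2)) ((q.1 - w.1) + (w.1 - p.1)) := by
      simpa only [sub_sub_sub_cancel_left, sub_add_sub_cancel] using hT q hq p hp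
    rw [sub_apply, map_add, map_add, hj.1] at hmono
    have hqw : (w.2 - p.2) (q.1 - w.1) ≤ δ * r :=
      (le_abs_self _).trans ((w.2 - p.2).le_of_opNorm_le hsnd _)
    have hwp : (w.2 - p.2) (w.1 - p.1) ≤ δ * δ :=
      (le_abs_self _).trans ((w.2 - p.2).le_of_opNorm_le_of_le hsnd hfst)
    have hjwp : -(w.2 - q.2) (w.1 - p.1) ≤ r * δ :=
      (neg_le_abs _).trans ((w.2 - q.2).le_of_opNorm_le_of_le hnorm.le hfst)
    linarith
  rw [hdist]
  nlinarith

theorem IsMonotone.eventually_mem_of_sub_mem_dualityMap (hT : IsMonotone T)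
    {p : X × StrongDual ℝ X} (hp : p ∈ gph T) (hW : W ∈ 𝓝 p) :
    ∀ᶠ w in 𝓝 p, ∀ q ∈ gph T, w.2 - q.2 ∈ dualityMap (q.1 - w.1) → q ∈ W := by
  obtain ⟨ε, hε, hball⟩ := Metric.mem_nhds_iff.mp hW
  filter_upwards [Metric.ball_mem_nhds p (show 0 < ε / 4 by positivity)] with w hw q hq hj
  refine hball (Metric.mem_ball.mpr ?_)
  linarith [dist_triangle q w p, hT.dist_le_of_sub_mem_dualityMap hp hq hj, Metric.mem_ball.mp hw]

theorem eq_of_sub_mem_dualityMap {w q : X × StrongDual ℝ X}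
    (hj : w.2 - q.2 ∈ dualityMap (q.1 - w.1)) (h : 0 ≤ (w.2 - q.2) (w.1 - q.1)) : w = q := by
  have hsq : ‖q.1 - w.1‖ ^ 2 ≤ 0 := by
    rw [← hj.1, ← neg_sub w.1 q.1, map_neg]
    exact neg_nonpos.mpr h
  have hzero : ‖q.1 - w.1‖ = 0 := pow_eq_zero_iff two_ne_zero |>.mp (hsq.antisymm (sq_nonneg _))
  have hfst : q.1 = w.1 := sub_eq_zero.mp (norm_eq_zero.mp hzero)
  have hsnd : w.2 = q.2 :=
    sub_eq_zero.mp (norm_eq_zero.mp ((norm_eq_of_mem_dualityMap hj).trans hzero))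
  exact Prod.ext hfst.symm hsnd

theorem LocallyStronglyMaximalMonotoneB.typeA (h : LocallyStronglyMaximalMonotoneB σ T x x')
    (hrefl : IsReflexiveSpace X) (hsmooth : GateauxSmooth X) (hσ : 0 ≤ σ)
    (hx : (x, x') ∈ gph T) : LocallyStronglyMaximalMonotoneA σ T x x' := by
  obtain ⟨U, V, hU, hV, hxU, hxV, T', hT', heq⟩ := h
  let N : Set (X × StrongDual ℝ X) := {w | w ∈ U ×ˢ V ∧
    ∀ q ∈ gph T', w.2 - q.2 ∈ dualityMap (q.1 - w.1) → q ∈ U ×ˢ V}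
  have mem_interior : ∀ q ∈ gph T', q ∈ U ×ˢ V → q ∈ interior N := fun q hq hqUV => by
    have hnhds := (hU.prod hV).mem_nhds hqUV
    have hresolvent := (hT'.1.isMonotone hσ).eventually_mem_of_sub_mem_dualityMap hq hnhds
    exact mem_interior_iff_mem_nhds.mpr (inter_mem hnhds hresolvent)
  have heqN : gph T' ∩ interior N = gph T ∩ interior N :=
    inter_eq_inter_of_subset heq fun w hw => (interior_subset hw).1
  have hxT' : (x, x') ∈ gph T' := (heq.symm.subset ⟨hx, hxU, hxV⟩).1
  have hT : IsStronglyMonotoneOn σ T (interior N) := ⟨T', hT'.1, heqN⟩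
  refine ⟨interior N, isOpen_interior, mem_interior _ hxT' ⟨hxU, hxV⟩,
    hT.isStronglyMaximalMonotoneOnA fun w hw hrelated => ?_⟩
  obtain ⟨q, hqT', hj⟩ := hT'.exists_sub_mem_dualityMap hrefl hsmooth hσ w
  have hq : q ∈ gph T ∩ interior N :=
    heqN.subset ⟨hqT', mem_interior q hqT' ((interior_subset hw).2 q hqT' hj)⟩
  rw [eq_of_sub_mem_dualityMap hj (hrelated q hq)]
  exact hq.1

theorem LocallyStronglyMaximalMonotoneA.typeB (h : LocallyStronglyMaximalMonotoneA σ T x x')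
    (hσ : 0 ≤ σ) : LocallyStronglyMaximalMonotoneB σ T x x' := by
  obtain ⟨W, hW, hxW, ⟨T₁, hT₁, heq⟩, hmax⟩ := h
  obtain ⟨T', hT', hsub⟩ := hT₁.exists_maximal
  have hTT' : gph T ∩ W = gph T' ∩ W :=
    hmax T' ⟨T', hT'.1.isMonotone hσ, rfl⟩ (heq ▸ Set.inter_subset_inter_left W hsub)
  obtain ⟨U, V, hU, hxU, hV, hxV, hUV⟩ := mem_nhds_prod_iff'.mp (hW.mem_nhds hxW)
  exact ⟨U, V, hU, hV, hxU, hxV, T', hT', inter_eq_inter_of_subset hTT'.symm hUV⟩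

theorem LocallyStronglyMaximalMonotoneARect.typeA
    (h : LocallyStronglyMaximalMonotoneARect σ T x x') :
    LocallyStronglyMaximalMonotoneA σ T x x' := by
  obtain ⟨U, V, hU, hV, hxU, hxV, h⟩ := h
  exact ⟨U ×ˢ V, hU.prod hV, ⟨hxU, hxV⟩, h⟩

theorem eq_of_forall_sub_apply_nonneg {V : Set (StrongDual ℝ X)} (hV : IsOpen V)
    {f : StrongDual ℝ X → X} (hf : ContinuousOn f V) {u : StrongDual ℝ X} (hu : u ∈ V)
    (h : ∀ v ∈ V, 0 ≤ (u - v) (x - f v)) : f u = x := by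
  -- Minty's trick: test with `v = u + t • k` and let `t` decrease to `0`.
  have hnonneg : ∀ k : StrongDual ℝ X, 0 ≤ k (f u - x) := fun k => by
    have hline : Tendsto (fun t : ℝ => u + t • k) (𝓝[>] 0) (𝓝 u) := by
      have hcont : Continuous fun t : ℝ => u + t • k := by fun_prop
      simpa using (hcont.tendsto 0).mono_left nhdsWithin_le_nhds
    have hlim : Tendsto (fun t : ℝ => k (f (u + t • k) - x)) (𝓝[>] 0) (𝓝 (k (f u - x))) :=
      (k.continuous.tendsto _).comp
        (((hf.continuousAt (hV.mem_nhds hu)).tendsto.comp hline).sub_const x)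
    refine ge_of_tendsto hlim ?_
    filter_upwards [hline.eventually (hV.mem_nhds hu), self_mem_nhdsWithin] with t htV ht
    have hrelated := h _ htV
    rw [sub_add_cancel_left, ← neg_sub (f _) x, map_neg, neg_apply, neg_neg, smul_apply,
      smul_eq_mul] at hrelated
    exact nonneg_of_mul_nonneg_right hrelated ht
  refine sub_eq_zero.mp (SeparatingDual.eq_zero_of_forall_dual_eq_zero (R := ℝ) fun k => ?_)
  exact le_antisymm (neg_nonneg.mp (hnonneg (-k))) (hnonneg k)

theorem LocallyStronglyMonotone.typeA_rectangle (h : LocallyStronglyMonotone σ T x x')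
    (hloc : HasContinuousSingleValuedLocalization (inv T) x' x) (hx : (x, x') ∈ gph T) :
    LocallyStronglyMaximalMonotoneARect σ T x x' := by
  obtain ⟨U, V, hU, hV, hxU, hxV, hT⟩ := h
  obtain ⟨V', U', f, hV', hU', hxV', hxU', hf, hgph⟩ := hloc
  have hfT : ∀ v ∈ V', (f v, v) ∈ gph T := fun v hv =>
    ((Set.ext_iff.mp hgph (v, f v)).mpr ⟨hv, rfl⟩).1
  have hfx : x = f x' := ((Set.ext_iff.mp hgph (x', x)).mp ⟨hx, hxV', hxU'⟩).2
  let V'' : Set (StrongDual ℝ X) := V ∩ (V' ∩ f ⁻¹' (U ∩ U'))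
  have hV'' : IsOpen V'' := hV.inter (hf.isOpen_inter_preimage hV' (hU.inter hU'))
  have hT'' : IsStronglyMonotoneOn σ T ((U ∩ U') ×ˢ V'') :=
    hT.mono (Set.prod_mono Set.inter_subset_left Set.inter_subset_left)
  refine ⟨U ∩ U', V'', hU.inter hU', hV'', ⟨hxU, hxU'⟩,
    ⟨hxV, hxV', Set.mem_preimage.mpr (hfx ▸ ⟨hxU, hxU'⟩)⟩,
    hT''.isStronglyMaximalMonotoneOnA fun w hw hrelated => ?_⟩
  have hfw : f w.2 = w.1 := by
    refine eq_of_forall_sub_apply_nonneg hV'' (hf.mono fun v hv => hv.2.1) hw.2 fun v hv => ?_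
    exact hrelated (f v, v) ⟨hfT v hv.2.1, hv.2.2, hv⟩
  have hwT := hfT w.2 hw.2.2.1
  rwa [hfw] at hwT

end LocalMaximality

section KadecKlee

variable {X : Type*} [NormedAddCommGroup X] [NormedSpace ℝ X] {x y : X} {j : StrongDual ℝ X}

theorem eq_of_mem_dualityMap_of_apply_eq [StrictConvexSpace ℝ X] (hj : j ∈ dualityMap x)
    (hy : ‖y‖ ≤ ‖x‖) (hjy : j y = ‖x‖ ^ 2) : y = x := by
  rcases (norm_nonneg x).eq_or_lt with hx | hx
  · rw [← hx] at hy
    rw [norm_eq_zero.mp hx.symm, norm_le_zero_iff.mp hy]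
  have hjy_le := apply_le_of_mem_dualityMap hj y
  have hjadd_le := apply_le_of_mem_dualityMap hj (y + x)
  rw [map_add, hj.1, hjy] at hjadd_le
  have hnorm : ‖y‖ = ‖x‖ := hy.antisymm (by nlinarith)
  refine eq_of_norm_eq_of_norm_add_eq hnorm ((norm_add_le _ _).antisymm ?_)
  rw [hnorm]
  nlinarith

theorem IsReflexiveSpace.exists_tendsto_apply {ι : Type*} (hX : IsReflexiveSpace X)
    (𝒰 : Ultrafilter ι) {u : ι → X} {r : ℝ} (hu : ∀ᶠ k in 𝒰, ‖u k‖ ≤ r) :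
    ∃ y, ∀ g : StrongDual ℝ X, Tendsto (fun k => g (u k)) 𝒰 (𝓝 (g y)) := by
  let ev : ι → WeakDual ℝ (StrongDual ℝ X) := fun k =>
    StrongDual.toWeakDual (NormedSpace.inclusionInDoubleDual ℝ X (u k))
  have hball : ∀ᶠ k in 𝒰, ev k ∈ WeakDual.toStrongDual ⁻¹'
      Metric.closedBall (0 : StrongDual ℝ (StrongDual ℝ X)) r := by
    filter_upwards [hu] with k hk
    exact (mem_closedBall_zero_iff (E := StrongDual ℝ (StrongDual ℝ X))).mpr
      ((NormedSpace.double_dual_bound ℝ X (u k)).trans hk)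
  obtain ⟨Φ, -, hΦ⟩ := (WeakDual.isCompact_closedBall (𝕜 := ℝ) (E := StrongDual ℝ X) 0
    r).ultrafilter_le_nhds (𝒰.map ev) (le_principal_iff.mpr hball)
  obtain ⟨y, hy⟩ := hX (WeakDual.toStrongDual Φ)
  refine ⟨y, fun g => ?_⟩
  rw [← NormedSpace.dual_def ℝ X y g, hy]
  exact ((WeakDual.eval_continuous g).tendsto Φ).comp hΦ

theorem norm_le_of_tendsto_apply {ι : Type*} {l : Filter ι} [l.NeBot] {u : ι → X} {r : ℝ}
    (hu : ∀ g : StrongDual ℝ X, Tendsto (fun k => g (u k)) l (𝓝 (g y)))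
    (hr : Tendsto (fun k => ‖u k‖) l (𝓝 r)) : ‖y‖ ≤ r := by
  obtain ⟨g, hg, hgy⟩ := exists_dual_vector'' ℝ y
  have hgr : g y ≤ r := le_of_tendsto_of_tendsto' (hu g) hr fun k =>
    (le_abs_self _).trans ((g.le_of_opNorm_le hg _).trans_eq (one_mul _))
  rwa [hgy] at hgr

theorem KadecKlee.tendsto_of_apply_tendsto [StrictConvexSpace ℝ X] (hK : KadecKlee X)
    (hrefl : IsReflexiveSpace X) {u : ℕ → X} (hj : j ∈ dualityMap x)
    (hnorm : Tendsto (fun k => ‖u k‖) atTop (𝓝 ‖x‖))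
    (hju : Tendsto (fun k => j (u k)) atTop (𝓝 (‖x‖ ^ 2))) : Tendsto u atTop (𝓝 x) := by
  refine hK u x (fun g => (tendsto_iff_ultrafilter _ _ _).mpr fun 𝒰 h𝒰 => ?_) hnorm
  have hbdd : ∀ᶠ k in 𝒰, ‖u k‖ ≤ ‖x‖ + 1 :=
    ((hnorm.mono_left h𝒰).eventually_lt_const (lt_add_one _)).mono fun _ hk => hk.le
  obtain ⟨y, hy⟩ := hrefl.exists_tendsto_apply 𝒰 hbdd
  have hjy : j y = ‖x‖ ^ 2 := tendsto_nhds_unique (hy j) (hju.mono_left h𝒰)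
  have hyx : ‖y‖ ≤ ‖x‖ := norm_le_of_tendsto_apply hy (hnorm.mono_left h𝒰)
  rw [← eq_of_mem_dualityMap_of_apply_eq hj hyx hjy]
  exact hy g

/-- A sum of two nonnegative terms that measures, for `j ∈ J(x)`, how far `u` is from being
supported by `j` on the sphere of radius `‖x‖`. For `k ∈ J(u)` it is at most
`⟨k - j, u - x⟩`. -/
def dualityGap (j : StrongDual ℝ X) (x u : X) : ℝ :=
  (‖u‖ - ‖x‖) ^ 2 + (‖x‖ * ‖u‖ - j u)

theorem sq_norm_sub_norm_le_dualityGap (hj : j ∈ dualityMap x) (u : X) :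
    (‖u‖ - ‖x‖) ^ 2 ≤ dualityGap j x u :=
  le_add_of_nonneg_right (sub_nonneg.mpr (apply_le_of_mem_dualityMap hj u))

theorem norm_mul_norm_sub_apply_le_dualityGap (j : StrongDual ℝ X) (x u : X) :
    ‖x‖ * ‖u‖ - j u ≤ dualityGap j x u :=
  le_add_of_nonneg_left (sq_nonneg _)

theorem dualityGap_le_sub_apply_sub {k : StrongDual ℝ X} (hk : k ∈ dualityMap y)
    (hj : j ∈ dualityMap x) : dualityGap j x y ≤ (k - j) (y - x) := by
  rw [sub_apply_sub_of_mem_dualityMap hk hj, dualityGap]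
  linarith [apply_le_of_mem_dualityMap hk x]

theorem eq_of_dualityGap_nonpos [StrictConvexSpace ℝ X] (hj : j ∈ dualityMap x)
    (h : dualityGap j x y ≤ 0) : y = x := by
  have hnorm : ‖y‖ = ‖x‖ := sub_eq_zero.mp (pow_eq_zero_iff two_ne_zero |>.mp
    (((sq_norm_sub_norm_le_dualityGap hj y).trans h).antisymm (sq_nonneg _)))
  refine eq_of_mem_dualityMap_of_apply_eq hj hnorm.le (le_antisymm ?_ ?_)
  · simpa only [hnorm, ← sq] using apply_le_of_mem_dualityMap hj y
  · have hgap := (norm_mul_norm_sub_apply_le_dualityGap j x y).trans h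
    rw [hnorm, ← sq] at hgap
    exact sub_nonpos.mp hgap

theorem KadecKlee.tendsto_of_dualityGap_tendsto_zero [StrictConvexSpace ℝ X] (hK : KadecKlee X)
    (hrefl : IsReflexiveSpace X) {u : ℕ → X} (hj : j ∈ dualityMap x)
    (h : Tendsto (fun k => dualityGap j x (u k)) atTop (𝓝 0)) : Tendsto u atTop (𝓝 x) := by
  have hnorm : Tendsto (fun k => ‖u k‖) atTop (𝓝 ‖x‖) := by
    have hsq : Tendsto (fun k => (‖u k‖ - ‖x‖) ^ 2) atTop (𝓝 0) :=
      squeeze_zero (fun _ => sq_nonneg _) (fun k => sq_norm_sub_norm_le_dualityGap hj (u k)) h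
    have habs := hsq.sqrt
    simp only [Real.sqrt_sq_eq_abs, Real.sqrt_zero] at habs
    exact tendsto_sub_nhds_zero_iff.mp ((tendsto_zero_iff_abs_tendsto_zero _).mpr habs)
  have hdefect : Tendsto (fun k => ‖x‖ * ‖u k‖ - j (u k)) atTop (𝓝 0) :=
    squeeze_zero (fun k => sub_nonneg.mpr (apply_le_of_mem_dualityMap hj (u k)))
      (fun k => norm_mul_norm_sub_apply_le_dualityGap j x (u k)) h
  refine hK.tendsto_of_apply_tendsto hrefl hj hnorm ?_
  simpa [sq] using (hnorm.const_mul ‖x‖).sub hdefect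

variable {σ : ℝ} {T : X → Set (StrongDual ℝ X)}

theorem IsStronglyMonotone.mul_dualityGap_le (hT : IsStronglyMonotone σ T) (hσ : 0 ≤ σ)
    {p q : X × StrongDual ℝ X} (hp : p ∈ gph T) (hq : q ∈ gph T) (hj : j ∈ dualityMap q.1) :
    σ * dualityGap j q.1 p.1 ≤ ‖p.2 - q.2‖ * (‖p.1‖ + ‖q.1‖) := by
  obtain ⟨k, hk⟩ := exists_mem_dualityMap p.1
  calc σ * dualityGap j q.1 p.1
      ≤ σ * (k - j) (p.1 - q.1) :=
        mul_le_mul_of_nonneg_left (dualityGap_le_sub_apply_sub hk hj) hσ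
    _ ≤ (p.2 - q.2) (p.1 - q.1) := hT p hp q hq k hk j hj
    _ ≤ ‖p.2 - q.2‖ * (‖p.1‖ + ‖q.1‖) :=
        (le_abs_self _).trans ((p.2 - q.2).le_opNorm_of_le (norm_sub_le _ _))

theorem IsStronglyMonotone.fst_eq_of_snd_eq [StrictConvexSpace ℝ X] (hT : IsStronglyMonotone σ T)
    (hσ : 0 < σ) {p q : X × StrongDual ℝ X} (hp : p ∈ gph T) (hq : q ∈ gph T) (h : p.2 = q.2) :
    p.1 = q.1 := by
  obtain ⟨j, hj⟩ := exists_mem_dualityMap q.1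
  have hgap := hT.mul_dualityGap_le hσ.le hp hq hj
  rw [h, sub_self, norm_zero, zero_mul] at hgap
  exact eq_of_dualityGap_nonpos hj (nonpos_of_mul_nonpos_right hgap hσ)

theorem IsStronglyMonotone.continuous_of_forall_mem_gph [StrictConvexSpace ℝ X]
    (hT : IsStronglyMonotone σ T) (hσ : 0 < σ) (hrefl : IsReflexiveSpace X) (hK : KadecKlee X)
    {f : StrongDual ℝ X → X} (hf : ∀ v, (f v, v) ∈ gph T) : Continuous f := by
  refine continuous_iff_seqContinuous.mpr fun v w hv => ?_
  obtain ⟨j, hj⟩ := exists_mem_dualityMap (f w)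
  let d : ℕ → ℝ := fun k => ‖v k - w‖ / σ
  have hd : Tendsto d atTop (𝓝 0) := by
    simpa using (tendsto_iff_norm_sub_tendsto_zero.mp hv).div_const σ
  have hgap : ∀ k, dualityGap j (f w) (f (v k)) ≤ d k * (‖f (v k)‖ + ‖f w‖) := fun k => by
    rw [div_mul_eq_mul_div, le_div_iff₀' hσ]
    exact hT.mul_dualityGap_le hσ.le (hf (v k)) (hf w) hj
  have hbdd : ∀ᶠ k in atTop, ‖f (v k)‖ ≤ 3 * ‖f w‖ + 1 := by
    filter_upwards [hd.eventually_le_const one_pos] with k hdk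
    have hsq : (‖f (v k)‖ - ‖f w‖) ^ 2 ≤ ‖f (v k)‖ + ‖f w‖ :=
      ((sq_norm_sub_norm_le_dualityGap hj _).trans (hgap k)).trans
        (mul_le_of_le_one_left (by positivity) hdk)
    nlinarith [norm_nonneg (f w)]
  have hlim : Tendsto (fun k => d k * (4 * ‖f w‖ + 1)) atTop (𝓝 0) := by
    simpa using hd.mul_const (4 * ‖f w‖ + 1)
  refine hK.tendsto_of_dualityGap_tendsto_zero hrefl hj (squeeze_zero' (.of_forall fun k => ?_)
    (hbdd.mono fun k hk => ?_) hlim)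
  · exact (sq_nonneg _).trans (sq_norm_sub_norm_le_dualityGap hj _)
  · refine (hgap k).trans (mul_le_mul_of_nonneg_left ?_ (by positivity))
    linarith

theorem IsStronglyMaximalMonotone.exists_continuous_inverse [StrictConvexSpace ℝ X]
    (hT : IsStronglyMaximalMonotone σ T) (hrefl : IsReflexiveSpace X) (hsmooth : GateauxSmooth X)
    (hσ : 0 < σ) (hK : KadecKlee X) :
    ∃ f : StrongDual ℝ X → X, Continuous f ∧ ∀ z v, (z, v) ∈ gph T ↔ z = f v := by
  choose f hf using hT.exists_mem_gph hrefl hsmooth hσ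
  exact ⟨f, hT.1.continuous_of_forall_mem_gph hσ hrefl hK hf, fun z v =>
    ⟨fun hz => hT.1.fst_eq_of_snd_eq hσ hz (hf v) rfl, fun hz => hz ▸ hf v⟩⟩

variable {x' : StrongDual ℝ X}

theorem LocallyStronglyMaximalMonotoneB.locallyStronglyMonotone
    (h : LocallyStronglyMaximalMonotoneB σ T x x') : LocallyStronglyMonotone σ T x x' := by
  obtain ⟨U, V, hU, hV, hxU, hxV, T', hT', heq⟩ := h
  exact ⟨U, V, hU, hV, hxU, hxV, T', hT'.1, heq⟩

theorem LocallyStronglyMaximalMonotoneB.hasContinuousSingleValuedLocalization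
    [StrictConvexSpace ℝ X] (h : LocallyStronglyMaximalMonotoneB σ T x x')
    (hrefl : IsReflexiveSpace X) (hsmooth : GateauxSmooth X) (hσ : 0 < σ) (hK : KadecKlee X)
    (hx : (x, x') ∈ gph T) : HasContinuousSingleValuedLocalization (inv T) x' x := by
  obtain ⟨U, V, hU, hV, hxU, hxV, T', hT', heq⟩ := h
  obtain ⟨f, hf, hT'f⟩ := hT'.exists_continuous_inverse hrefl hsmooth hσ hK
  have hfx : x = f x' := (hT'f x x').mp (heq.symm.subset ⟨hx, hxU, hxV⟩).1
  refine ⟨V ∩ f ⁻¹' U, U, f, hV.inter (hU.preimage hf), hU,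
    ⟨hxV, Set.mem_preimage.mpr (hfx ▸ hxU)⟩, hxU, hf.continuousOn, Set.Subset.antisymm ?_ ?_⟩
  · rintro ⟨v, z⟩ ⟨hz, hv, hzU⟩
    have hzT' : (z, v) ∈ gph T' := ((Set.ext_iff.mp heq (z, v)).mpr ⟨hz, hzU, hv.1⟩).1
    exact ⟨hv, (hT'f z v).mp hzT'⟩
  · rintro ⟨v, z⟩ ⟨hv, hz⟩
    obtain rfl : z = f v := hz
    exact ⟨((Set.ext_iff.mp heq (f v, v)).mp ⟨(hT'f _ _).mpr rfl, hv.2, hv.1⟩).1, hv, hv.2⟩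

end KadecKlee

end LocMono

theorem mainTheorem4_general {X : Type*} [NormedAddCommGroup X] [NormedSpace ℝ X]
    (hrefl : LocMono.IsReflexiveSpace X) (hsmooth : LocMono.GateauxSmooth X)
    (T : X → Set (StrongDual ℝ X)) (x : X) (x' : StrongDual ℝ X) (hx : (x, x') ∈ LocMono.gph T)
    (σ : ℝ) (hσ : 0 ≤ σ) :
    (LocMono.LocallyStronglyMaximalMonotoneB σ T x x' ↔
      LocMono.LocallyStronglyMaximalMonotoneA σ T x x') ∧
    (LocMono.LocallyStronglyMaximalMonotoneARect σ T x x' →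
      LocMono.LocallyStronglyMaximalMonotoneB σ T x x') ∧
    (0 < σ → StrictConvexSpace ℝ X → LocMono.KadecKlee X →
      (LocMono.LocallyStronglyMaximalMonotoneB σ T x x' ↔
        LocMono.LocallyStronglyMonotone σ T x x' ∧
          LocMono.HasContinuousSingleValuedLocalization (LocMono.inv T) x' x) ∧
      (LocMono.LocallyStronglyMaximalMonotoneB σ T x x' ↔
        LocMono.LocallyStronglyMaximalMonotoneARect σ T x x')) := by
  refine ⟨⟨fun h => h.typeA hrefl hsmooth hσ hx, fun h => h.typeB hσ⟩,
    fun h => h.typeA.typeB hσ, fun hσ_pos _ hK => ?_⟩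
  have localization : LocMono.LocallyStronglyMaximalMonotoneB σ T x x' →
      LocMono.LocallyStronglyMonotone σ T x x' ∧
        LocMono.HasContinuousSingleValuedLocalization (LocMono.inv T) x' x := fun h =>
    ⟨h.locallyStronglyMonotone,
      h.hasContinuousSingleValuedLocalization hrefl hsmooth hσ_pos hK hx⟩
  have rectangle : LocMono.LocallyStronglyMonotone σ T x x' ∧
        LocMono.HasContinuousSingleValuedLocalization (LocMono.inv T) x' x →
      LocMono.LocallyStronglyMaximalMonotoneARect σ T x x' := fun h =>
    h.1.typeA_rectangle h.2 hx
  exact ⟨⟨localization, fun h => (rectangle h).typeA.typeB hσ⟩,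
    fun h => rectangle (localization h), fun h => h.typeA.typeB hσ⟩

theorem mainTheorem4 {X : Type*} [NormedAddCommGroup X] [NormedSpace ℝ X] [CompleteSpace X]
    (hrefl : LocMono.IsReflexiveSpace X) (hsmooth : LocMono.GateauxSmooth X)
    (T : X → Set (StrongDual ℝ X)) (x : X) (x' : StrongDual ℝ X) (hx : (x, x') ∈ LocMono.gph T)
    (σ : ℝ) (hσ : 0 < σ) :
    (LocMono.LocallyStronglyMaximalMonotoneB σ T x x' ↔
      LocMono.LocallyStronglyMaximalMonotoneA σ T x x') ∧
    (LocMono.LocallyStronglyMaximalMonotoneARect σ T x x' →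
      LocMono.LocallyStronglyMaximalMonotoneB σ T x x') ∧
    (LocMono.FrechetSmooth X → StrictConvexSpace ℝ X → LocMono.KadecKlee X →
      (LocMono.LocallyStronglyMaximalMonotoneB σ T x x' ↔
        LocMono.LocallyStronglyMonotone σ T x x' ∧
          LocMono.HasContinuousSingleValuedLocalization (LocMono.inv T) x' x) ∧
      (LocMono.LocallyStronglyMaximalMonotoneB σ T x x' ↔
        LocMono.LocallyStronglyMaximalMonotoneARect σ T x x')) := by
  obtain ⟨typeA, rectangle, localization⟩ := mainTheorem4_general hrefl hsmooth T x x' hx σ hσ.le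
  exact ⟨typeA, rectangle, fun _ => localization hσ⟩
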